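/- Let $F_\bullet$ be a non-Archimedean local field of odd residual characteristic, $F/F_\bullet$ a quadratic extension with non-trivial Galois automorphism $c$, and $V$ a finite-dimensional $F$-vector space with a non-degenerate $\epsilon$-Hermitian form $h$ relative to $F/F_\bullet$ ($\epsilon=\pm1$). Let $X\mapsto\bar X$ be the adjoint anti-involution of $A=\mathrm{End}_F(V)$ and ${}^\alpha X=-\bar X$. Strata. Let $\Lambda=(\Lambda(k))_{k\in\mathbb Z}$ be a strictly decreasing $\mathfrak o_F$-lattice chain in $V$, $\mathfrak P^k=\{x\in A: x\Lambda(m)\subseteq\Lambda(m+k)\ \forall m\}$, $\mathfrak A=\mathfrak P^0$, and $\nu_{\mathfrak A}(x)=\max\{k:x\in\mathfrak P^k\}$. For integers $n>r$, the stratum $[\mathfrak A,n,r,\gamma]$ is pure if $F[\gamma]$ is a field, $F[\gamma]^\times$ normalizes $\mathfrak A$ and $\nu_{\mathfrak A}(\gamma)=-n$. In that case $k_0(\gamma,\mathfrak A)$ is the greatest integer $k$ such that $\{x\in\mathfrak A:\gamma x-x\gamma\in\mathfrak P^k\}$ is not contained in $\mathfrak B_\gamma+\mathfrak P$, where $\mathfrak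 B_\gamma$ is the centralizer of $\gamma$ in $\mathfrak A$, with $k_0(\gamma,\mathfrak A)=-\infty$ if $\gamma\in F$. The stratum is simple if it is pure and $r<-k_0(\gamma,\mathfrak A)$. Strata $[\mathfrak A,n,r,\gamma]$ and $[\mathfrak A,n,r,\gamma']$ are equivalent if $\gamma-\gamma'\in\mathfrak P^{-r}$. The same definitions apply, with $F$ replaced by a field $K=F[\gamma]$, to the algebra $\mathrm{End}_K(V)$ and its order $\mathfrak B_\gamma$. Let $[\mathfrak A,n,0,\beta]$ be a skew simple stratum: it is simple, ${}^\alpha\beta=\beta$, and $\Lambda$ is self-dual, i.e. for some integer $a$ one has $\{v\in V:h(v,\Lambda(k))\subseteq\mathfrak p_F\}=\Lambda(a-k)$ for all $k$. Put $E=F[\beta]$, let $E_\bullet$ be the fixed field of $X\mapsto\bar X$ on $E$, and assume that $\mathfrak A\cap\mathrm{End}_E(V)$ is a maximal order, i.e. $\mathfrak p_E\Lambda(k)=\Lambda(k+1)$ for all $k$. Let $\gamma_0=\beta,\gamma_1,\dots,\gamma_d$ and $r_0<r_1<\dots<r_d=n$ be an approximating sequence with its critical exponents. That is, $r_j=-k_0(\gamma_j,\mathfrak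 A)$ for $0\le j<d$; $k_0(\gamma_d,\mathfrak A)\in\{-n,-\infty\}$; and for $0\le j<d$ the stratum $[\mathfrak A,n,r_j,\gamma_{j+1}]$ is simple and equivalent to $[\mathfrak A,n,r_j,\gamma_j]$, and the derived stratum $[\mathfrak B_{\gamma_{j+1}},r_j,r_j-1,s_{j+1}(\gamma_j-\gamma_{j+1})]$ is equivalent to a simple stratum $[\mathfrak B_{\gamma_{j+1}},r_j,r_j-1,\delta_j]$ in the centralizer of $\gamma_{j+1}$. Here $s_{j+1}$ is a tame corestriction on $A$ relative to $F[\gamma_{j+1}]/F$, that is, a bimodule homomorphism from $A$ onto the centralizer $B$ of $\gamma_{j+1}$, over $B$ on both sides, that maps each hereditary $\mathfrak o_F$-order $\mathfrak A'$ normalized by $F[\gamma_{j+1}]^\times$ onto $\mathfrak A'\cap B$. If $E/E_\bullet$ is (quadratic) ramified, then all critical exponents $r_j$, $j=0,1,\dots,d$, are odd. -/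

import Mathlib

open ValuativeRel

namespace SkewStrata

section Strata

variable {F V : Type*} [Field F] [ValuativeRel F] [TopologicalSpace F]
  [IsNonarchimedeanLocalField F] [AddCommGroup V] [Module F V]

/-- `Λ` is an `𝔬_F`-lattice chain in `V`: a strictly decreasing family of full `𝔬_F`-lattices
indexed by `ℤ`, such that `𝔭_F Λ(k) = Λ(k + e)` for some fixed period `e ≥ 1`. -/
structure IsLatticeChain (Λ : ℤ → Submodule 𝒪[F] V) : Prop where
  fg : ∀ k, (Λ k).FG
  span_eq_top : ∀ k, Submodule.span F (Λ k : Set V) = ⊤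
  strictAnti : StrictAnti Λ
  periodic : ∃ e : ℕ, 0 < e ∧ ∀ k, 𝓂[F] • Λ k = Λ (k + e)

/-- The group `𝔓^k = {x ∈ End_F(V) : x Λ(m) ⊆ Λ(m + k) for all m}`. So `radPow Λ 0` is the
hereditary order `𝔄` of `Λ`, and for a lattice chain `radPow Λ k` is the `k`-th power of its
radical `𝔓`. The valuation `ν_𝔄(x)` is the largest `k` with `x ∈ radPow Λ k`. -/
def radPow (Λ : ℤ → Submodule 𝒪[F] V) (k : ℤ) : AddSubgroup (Module.End F V) where
  carrier := {x | ∀ (m : ℤ), ∀ v ∈ Λ m, x v ∈ Λ (m + k)}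
  zero_mem' := fun m v _ => by simp
  add_mem' := fun {x y} hx hy m v hv => by
    simpa using (Λ (m + k)).add_mem (hx m v hv) (hy m v hv)
  neg_mem' := fun {x} hx m v hv => by
    simpa using (Λ (m + k)).neg_mem (hx m v hv)

/-- The subalgebra `K[b]` of `End_F(V)` generated by a subalgebra `K` and an element `b`. -/
def adjoinElt (K : Subalgebra F (Module.End F V)) (b : Module.End F V) :
    Subalgebra F (Module.End F V) :=
  Algebra.adjoin F ((K : Set (Module.End F V)) ∪ {b})

/-- The `F`-algebra `F[b]`. -/
def fieldOf (b : Module.End F V) : Subalgebra F (Module.End F V) := Algebra.adjoin F {b}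

/-- Every nonzero element of `L` permutes the lattices of `Λ` by a shift. When `L` is a field and
`Λ` is an `𝔬_F`-lattice chain, this says that `Λ` is an `𝔬_L`-lattice chain, or equivalently that
`L^×` normalizes the hereditary order of `Λ`. -/
def Normalizes (L : Subalgebra F (Module.End F V)) (Λ : ℤ → Submodule 𝒪[F] V) : Prop :=
  ∀ x ∈ L, x ≠ 0 → ∃ k : ℤ, ∀ i, x '' (Λ i : Set V) = Λ (i + k)

/-! In the next definitions `K` is a field in `End_F(V)` (either `F` itself, or `F[γ]`), the
algebra in which strata are considered is the centralizer `B_K = End_K(V)`, with the hereditary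
order `𝔅 = 𝔄 ∩ B_K`, and `𝔔^k = 𝔓^k ∩ B_K`. The case `K = ⊥` is that of strata in `End_F(V)`. -/

/-- The set of integers `k` such that `𝔑_k(b, 𝔅) = {x ∈ 𝔅 : bx - xb ∈ 𝔔^k}` is not contained
in `𝔅_b + 𝔔`, where `𝔅_b` is the centralizer of `b` in `𝔅`. When `K[b]` is a field that
normalizes `𝔅`, the critical exponent `k₀(b, 𝔅)` is the greatest element of this set; the set is
empty exactly when `K[b] = K`, in which case `k₀(b, 𝔅) = -∞`. -/
def critSet (Λ : ℤ → Submodule 𝒪[F] V) (K : Subalgebra F (Module.End F V))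
    (b : Module.End F V) : Set ℤ :=
  {k | ¬ ∀ x ∈ Subalgebra.centralizer F (K : Set (Module.End F V)),
    x ∈ radPow Λ 0 → b * x - x * b ∈ radPow Λ k →
      ∃ y ∈ Subalgebra.centralizer F (K : Set (Module.End F V)),
        y ∈ radPow Λ 0 ∧ b * y = y * b ∧ x - y ∈ radPow Λ 1}

/-- The stratum `[𝔅, n, r, b]` in `B_K` is pure: `K[b]` is a field whose nonzero elements
normalize `𝔅`, and `ν_𝔅(b) = -n`. -/
structure IsPure (Λ : ℤ → Submodule 𝒪[F] V) (K : Subalgebra F (Module.End F V))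
    (n r : ℤ) (b : Module.End F V) : Prop where
  lt : r < n
  mem_centralizer : b ∈ Subalgebra.centralizer F (K : Set (Module.End F V))
  isField : IsField (adjoinElt K b)
  normalizes : Normalizes (adjoinElt K b) Λ
  mem : b ∈ radPow Λ (-n)
  notMem : b ∉ radPow Λ (-n + 1)

/-- The stratum `[𝔅, n, r, b]` in `B_K` is simple: it is pure and `r < -k₀(b, 𝔅)`. -/
structure IsSimple (Λ : ℤ → Submodule 𝒪[F] V) (K : Subalgebra F (Module.End F V))
    (n r : ℤ) (b : Module.End F V) : Prop extends IsPure Λ K n r b where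
  lt_neg : ∀ k ∈ critSet Λ K b, r < -k

/-- A tame corestriction on `A = End_F(V)` relative to `K/F`: a `(B_K, B_K)`-bimodule
homomorphism `s : A → B_K` such that `s(𝔄) = 𝔄 ∩ B_K` for each hereditary `𝔬_F`-order `𝔄` in `A`
normalized by `K^×`. -/
structure IsTameCorestriction (K : Subalgebra F (Module.End F V))
    (s : Module.End F V →+ Module.End F V) : Prop where
  mem_centralizer : ∀ x, s x ∈ Subalgebra.centralizer F (K : Set (Module.End F V))
  map_mul_left : ∀ b ∈ Subalgebra.centralizer F (K : Set (Module.End F V)), ∀ x,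
    s (b * x) = b * s x
  map_mul_right : ∀ b ∈ Subalgebra.centralizer F (K : Set (Module.End F V)), ∀ x,
    s (x * b) = s x * b
  image_order : ∀ M : ℤ → Submodule 𝒪[F] V, IsLatticeChain M → Normalizes K M →
    s '' (radPow M 0 : Set (Module.End F V)) =
      (radPow M 0 : Set (Module.End F V)) ∩
        (Subalgebra.centralizer F (K : Set (Module.End F V)) : Set (Module.End F V))

/-- `γ 0 = β, γ 1, …, γ d` and `r 0 < r 1 < ⋯ < r d = n` form an approximating (or defining)
sequence of the simple stratum `[𝔄, n, 0, β]`, with critical exponents `r 0, …, r d`. The last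
exponent `r d = n` belongs to the step from `γ d` to the null element `γ (d + 1) = 0`; the values
of `γ` and `r` at arguments larger than `d` play no role. -/
structure IsApproximatingSequence (Λ : ℤ → Submodule 𝒪[F] V) (n : ℤ) (β : Module.End F V)
    (d : ℕ) (γ : ℕ → Module.End F V) (r : ℕ → ℤ) : Prop where
  init : γ 0 = β
  last : r d = n
  lt_succ : ∀ j < d, r j < r (j + 1)
  /-- `[𝔄, n, 0, γ 0]` is simple. -/
  simple_zero : IsSimple Λ ⊥ n 0 (γ 0)
  /-- `[𝔄, n, r j, γ (j + 1)]` is simple. -/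
  simple_succ : ∀ j < d, IsSimple Λ ⊥ n (r j) (γ (j + 1))
  /-- `[𝔄, n, r j, γ (j + 1)]` is equivalent to `[𝔄, n, r j, γ j]`. -/
  equivalent : ∀ j < d, γ j - γ (j + 1) ∈ radPow Λ (-r j)
  /-- `r j = -k₀(γ j, 𝔄)` for `j < d`. -/
  critical : ∀ j < d, IsGreatest (critSet Λ ⊥ (γ j)) (-r j)
  /-- `k₀(γ d, 𝔄)` is `-n` or `-∞`. -/
  minimal : IsGreatest (critSet Λ ⊥ (γ d)) (-n) ∨ critSet Λ ⊥ (γ d) = ∅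
  /-- The derived stratum `[𝔅_{j+1}, r j, r j - 1, s_{j+1}(γ j - γ (j + 1))]` in the centralizer of
  `γ (j + 1)` is equivalent to a simple stratum `[𝔅_{j+1}, r j, r j - 1, δ]`. -/
  derived : ∀ j < d, ∃ s : Module.End F V →+ Module.End F V,
    IsTameCorestriction (fieldOf (γ (j + 1))) s ∧
    ∃ δ : Module.End F V, IsSimple Λ (fieldOf (γ (j + 1))) (r j) (r j - 1) δ ∧
      s (γ j - γ (j + 1)) - δ ∈ radPow Λ (-(r j - 1))

/-- For a subset `S` of `End_F(V)` that is a field, `u` is a unit of the ring of integers `𝔬_S`,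
the set of elements of `S` that are integral over `𝔬_F`. -/
def IsIntegerUnit (S : Set (Module.End F V)) (u : Module.End F V) : Prop :=
  u ∈ S ∧ IsIntegral 𝒪[F] u ∧ ∃ w ∈ S, IsIntegral 𝒪[F] w ∧ u * w = 1

/-- For a subset `S` of `End_F(V)` that is a field, `ϖ` is a uniformizer of `S`: it generates the
ideal of non-units of the ring of integers `𝔬_S`. -/
structure IsUniformizer (S : Set (Module.End F V)) (ϖ : Module.End F V) : Prop where
  mem : ϖ ∈ S
  isIntegral : IsIntegral 𝒪[F] ϖ
  not_unit : ¬ IsIntegerUnit S ϖ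
  dvd : ∀ x ∈ S, IsIntegral 𝒪[F] x → ¬ IsIntegerUnit S x →
    ∃ y ∈ S, IsIntegral 𝒪[F] y ∧ x = ϖ * y

/-- The period of the `𝔬_E`-lattice chain `Λ` over `𝔬_E` is one, that is, `𝔭_E Λ(k) = Λ(k + 1)`;
equivalently, `𝔄 ∩ End_E(V)` is a maximal order of `End_E(V)`. -/
def HasPeriodOne (Λ : ℤ → Submodule 𝒪[F] V) (E : Subalgebra F (Module.End F V)) : Prop :=
  ∃ ϖ, IsUniformizer (E : Set (Module.End F V)) ϖ ∧ ∀ k, ϖ '' (Λ k : Set V) = Λ (k + 1)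

end Strata

section Hermitian

variable {F V : Type*} [Field F] [ValuativeRel F] [TopologicalSpace F]
  [IsNonarchimedeanLocalField F] [AddCommGroup V] [Module F V] {c : F →+* F}

/-- `h` is a non-degenerate `ε`-Hermitian form with respect to `c`, with `ε = ±1`. -/
structure IsHermitianForm (h : V →ₗ[F] V →ₛₗ[c] F) (ε : F) : Prop where
  sign : ε = 1 ∨ ε = -1
  symm : ∀ v w, h v w = ε * c (h w v)
  nondegenerate : ∀ v, (∀ w, h v w = 0) → v = 0

/-- The lattice chain `Λ` is self-dual: for some `a`, the dual `{v : h(v, Λ(k)) ⊆ 𝔭_F}` of `Λ(k)`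
is `Λ(a - k)` for all `k`. -/
def IsSelfDual (h : V →ₗ[F] V →ₛₗ[c] F) (Λ : ℤ → Submodule 𝒪[F] V) : Prop :=
  ∃ a : ℤ, ∀ k v, v ∈ Λ (a - k) ↔ ∀ w ∈ Λ k, ∃ t ∈ 𝓂[F], h v w = (t : F)

/-- `β` equals its image under the anti-involution `α : X ↦ -X̄`, where `X̄` is the adjoint of `X`
with respect to `h`. -/
def IsSkew (h : V →ₗ[F] V →ₛₗ[c] F) (β : Module.End F V) : Prop :=
  ∀ v w, h (β v) w = h v (-(β w))

/-- The fixed points `E_•` in `E` of the adjoint involution `X ↦ X̄ = -α(X)`. -/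
def fixedField (h : V →ₗ[F] V →ₛₗ[c] F) (E : Subalgebra F (Module.End F V)) :
    Set (Module.End F V) :=
  {x | x ∈ E ∧ ∀ v w, h (x v) w = h v (x w)}

/-- The quadratic extension `E / E_•` is ramified, `e(E / E_•) = 2`: a uniformizer of `E_•` is
a unit of `𝔬_E` times the square of a uniformizer of `E`. -/
def IsRamifiedOverFixed (h : V →ₗ[F] V →ₛₗ[c] F) (E : Subalgebra F (Module.End F V)) : Prop :=
  ∃ ϖ ϖ' u, IsUniformizer (E : Set (Module.End F V)) ϖ ∧ IsUniformizer (fixedField h E) ϖ' ∧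
    IsIntegerUnit (E : Set (Module.End F V)) u ∧ ϖ' = u * ϖ ^ 2

/-- `[𝔄, n, 0, β]`, with `𝔄` the hereditary order of the lattice chain `Λ`, is a skew simple
stratum in `End_F(V)`. -/
structure IsSkewSimple (h : V →ₗ[F] V →ₛₗ[c] F) (Λ : ℤ → Submodule 𝒪[F] V) (n : ℤ)
    (β : Module.End F V) : Prop where
  chain : IsLatticeChain Λ
  simple : IsSimple Λ ⊥ n 0 β
  selfDual : IsSelfDual h Λ
  skew : IsSkew h β

end Hermitian

end SkewStrata

namespace SkewStrata

/-! ### Sign-graded involutions of a lattice chain and the parity of critical exponents. -/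

section Parity

variable {F V : Type*} [Field F] [ValuativeRel F] [AddCommGroup V] [Module F V]

/-! Since `E/E_•` is ramified and 2 is a unit, the adjoint involution acts on `𝔭_E^k/𝔭_E^(k+1)` by
`(-1)^k` (`bar_sub_mem`). Period one makes `Λ(0)` a free `𝔬_E`-module with `Λ(k) = 𝔭_E^k Λ(0)`.
Applying the involution to coordinates in a basis of `Λ(0)` gives a `c`-semilinear involution `τ` of
`V` acting by `(-1)^k` on `Λ(k)/Λ(k+1)` (`exists_parity_involution`). Conjugation by `τ` then acts
by `(-1)^k` on `𝔓^k/𝔓^(k+1)`, and sends `β` to `-β` because `β` is a skew element of `E`.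

An element of exact valuation `k` that is anti-invariant modulo `𝔓^(k+1)` forces `k` to be odd; for
`β` this gives `n = r_d`. For `j < d`, `γ_j` is anti-invariant modulo a power of `𝔓` deeper than `k
= k₀(γ_j, 𝔄)`, as it is close to `β`. A witness `x` for `k` can be averaged over the conjugation
without changing it modulo `𝔓`. If `k` were even, the commutator of the average with `γ_j` would
fall into `𝔓^(k+1)`, against the maximality of `k` (`odd_critical`). -/

lemma mul_mem_radPow {Λ : ℤ → Submodule 𝒪[F] V} {x y : Module.End F V} {k l : ℤ}
    (hx : x ∈ radPow Λ k) (hy : y ∈ radPow Λ l) : x * y ∈ radPow Λ (k + l) := fun m v hv => by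
  have := hx _ _ (hy m v hv)
  rwa [add_assoc, add_comm l k] at this

lemma radPow_anti {Λ : ℤ → Submodule 𝒪[F] V} (hΛ : Antitone Λ) : Antitone (radPow Λ) :=
  fun _ _ h _ hx m v hv => hΛ (by lia) (hx m v hv)

/-- `τ` is an involution of `V`, semilinear over an involution `σ` of `F`, that acts by the sign
`(-1)^k` on the quotient `Λ(k) / Λ(k + 1)`. -/
structure IsParityInvolution (Λ : ℤ → Submodule 𝒪[F] V) (σ : F →+* F) (τ : V →+ V) : Prop where
  map_smul : ∀ (a : F) v, τ (a • v) = σ a • τ v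
  field_involutive : ∀ a, σ (σ a) = a
  involutive : ∀ v, τ (τ v) = v
  parity : ∀ k, ∀ v ∈ Λ k, τ v - (k.negOnePow : ℤ) • v ∈ Λ (k + 1)

namespace IsParityInvolution

variable {Λ : ℤ → Submodule 𝒪[F] V} {σ : F →+* F} {τ : V →+ V}

/-- Conjugation by a parity involution. -/
def conj (hτ : IsParityInvolution Λ σ τ) : Module.End F V →+ Module.End F V where
  toFun x :=
    { toFun := fun v => τ (x (τ v))
      map_add' := fun v w => by simp
      map_smul' := fun a v => by simp [hτ.map_smul, hτ.field_involutive] }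
  map_zero' := by ext; simp
  map_add' x y := by ext; simp

lemma conj_apply (hτ : IsParityInvolution Λ σ τ) (x : Module.End F V) (v : V) :
    hτ.conj x v = τ (x (τ v)) := rfl

lemma conj_mul (hτ : IsParityInvolution Λ σ τ) (x y : Module.End F V) :
    hτ.conj (x * y) = hτ.conj x * hτ.conj y := by
  ext v; simp [conj_apply, hτ.involutive]

/-- On `Λ(i)` the inner `τ` contributes `(-1)^i` and the outer one `(-1)^(i+k)`; their product is
`(-1)^k`. -/
lemma conj_sub_mem (hτ : IsParityInvolution Λ σ τ) (hΛ : Antitone Λ) {x : Module.End F V}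
    {k : ℤ} (hx : x ∈ radPow Λ k) :
    hτ.conj x - (k.negOnePow : ℤ) • x ∈ radPow Λ (k + 1) := by
  intro i v hv
  have mem : ∀ j, ∀ w ∈ Λ j, τ w ∈ Λ j := fun j w hw => by
    have := (Λ j).add_mem (hΛ (by lia : j ≤ j + 1) (hτ.parity j w hw))
      (zsmul_mem hw (j.negOnePow : ℤ))
    simpa using this
  have h1 := mem _ _ (hx _ _ (hτ.parity i v hv))
  have h2 := zsmul_mem (hτ.parity _ _ (hx i v hv)) (i.negOnePow : ℤ)
  have key : (hτ.conj x - (k.negOnePow : ℤ) • x) v =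
      τ (x (τ v - (i.negOnePow : ℤ) • v)) +
        (i.negOnePow : ℤ) • (τ (x v) - ((i + k).negOnePow : ℤ) • x v) := by
    have hi : (i.negOnePow : ℤ) * (i.negOnePow : ℤ) = 1 := by
      rw [← Units.val_mul, ← Int.negOnePow_add, Int.negOnePow_even _ ⟨i, rfl⟩]; rfl
    simp only [LinearMap.sub_apply, conj_apply, LinearMap.smul_apply, map_sub, map_zsmul,
      smul_sub, smul_smul, Int.negOnePow_add, Units.val_mul, ← mul_assoc, hi, one_mul]
    abel
  rw [key]
  have e1 : i + 1 + k = i + (k + 1) := by ring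
  have e2 : i + k + 1 = i + (k + 1) := by ring
  rw [e1] at h1
  rw [e2] at h2
  exact add_mem h1 h2

/-- Elements of `𝔓^k` that are anti-invariant modulo `𝔓^(k + 1)` lie in `𝔓^(k + 1)` for `k`
even. -/
lemma odd_of_add_conj_mem (hτ : IsParityInvolution Λ σ τ) (hΛ : Antitone Λ) {t : 𝒪[F]}
    (ht : 2 * t = 1) {x : Module.End F V} {k : ℤ} (hx : x ∈ radPow Λ k)
    (hx' : x ∉ radPow Λ (k + 1)) (h : x + hτ.conj x ∈ radPow Λ (k + 1)) : Odd k := by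
  by_contra hk
  have hk := Int.not_odd_iff_even.1 hk
  apply hx'
  -- For `k` even `x` is congruent to its conjugate, so `2x` lies in `𝔓^(k+1)`, and `t` is the
  -- inverse of 2.
  have h1 := sub_mem h (hτ.conj_sub_mem hΛ hx)
  rw [Int.negOnePow_even _ hk, Units.val_one, one_smul,
    show x + hτ.conj x - (hτ.conj x - x) = x + x by abel] at h1
  intro m v hv
  have h2 := (Λ _).smul_mem t (h1 m v hv)
  have e : t • (x + x) v = x v := by
    rw [LinearMap.add_apply, ← two_smul 𝒪[F] (x v), smul_smul, mul_comm, ht, one_smul]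
  rwa [e] at h2

/-- If `γ` is anti-invariant under the parity involution modulo `𝔓^m`, with `m > k₀(γ, 𝔄)`, then
the critical exponent `k₀(γ, 𝔄)` is odd. -/
theorem odd_critical (hτ : IsParityInvolution Λ σ τ) (hΛ : Antitone Λ) {t : 𝒪[F]}
    (ht : 2 * t = 1) {γ : Module.End F V} {k m : ℤ} (hk : IsGreatest (critSet Λ ⊥ γ) k)
    (hkm : k < m) (hγ : γ + hτ.conj γ ∈ radPow Λ m) : Odd k := by
  have hbot : ∀ x : Module.End F V,
      x ∈ Subalgebra.centralizer F ((⊥ : Subalgebra F (Module.End F V)) : Set _) := fun x => by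
    rw [Subalgebra.mem_centralizer_iff]
    intro g hg
    obtain ⟨a, rfl⟩ := Algebra.mem_bot.1 hg
    exact Algebra.commutes a x
  obtain ⟨hk, hmax⟩ := hk
  simp only [critSet, Set.mem_ofPred_eq, not_forall] at hk
  obtain ⟨x, -, hx0, hxk, hxn⟩ := hk
  have hc := hτ.conj_sub_mem hΛ hx0
  rw [Int.negOnePow_zero, Units.val_one, one_smul, zero_add] at hc
  have htm : ∀ {y : Module.End F V} {l : ℤ}, y ∈ radPow Λ l → (t : F) • y ∈ radPow Λ l :=
    fun hy i v hv => (Λ _).smul_mem t (hy i v hv)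
  have htF : (t : F) + t = 1 := by
    rw [← two_mul]; exact congrArg Subtype.val ht
  have hc0 : hτ.conj x ∈ radPow Λ 0 := by
    have := add_mem (radPow_anti hΛ zero_le_one hc) hx0
    simpa using this
  -- The average of `x` and its conjugate: still `x` modulo `𝔓`, since conjugation is trivial on
  -- `𝔄/𝔓`.
  set z : Module.End F V := (t : F) • (x + hτ.conj x) with hz
  have hz0 : z ∈ radPow Λ 0 := htm (add_mem hx0 hc0)
  have hxz : x - z ∈ radPow Λ 1 := by
    have e : x - z = -((t : F) • (hτ.conj x - x)) := by
      have : x = ((t : F) + t) • x := by rw [htF, one_smul]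
      rw [hz]
      nth_rewrite 1 [this]
      rw [add_smul, smul_add, smul_sub]; abel
    rw [e]
    exact neg_mem (htm hc)
  have hzk : γ * z - z * γ ∉ radPow Λ (k + 1) := by
    intro hmem
    have : k + 1 ∉ critSet Λ ⊥ γ := fun h => by have := hmax h; lia
    simp only [critSet, Set.mem_ofPred_eq, not_not] at this
    obtain ⟨y, hy, hy0, hyγ, hyz⟩ := this z (hbot z) hz0 hmem
    exact hxn ⟨y, hy, hy0, hyγ, by simpa using add_mem hxz hyz⟩
  set y := γ * x - x * γ with hy
  -- The error from `γ` being anti-invariant only modulo `𝔓^m`: replacing `γ` by `-hτ.conj γ` in its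
  -- commutator with `hτ.conj x` costs exactly `w`.
  set w := (γ + hτ.conj γ) * hτ.conj x - hτ.conj x * (γ + hτ.conj γ) with hw
  have hwm : w ∈ radPow Λ (k + 1) := by
    apply radPow_anti hΛ (by lia : k + 1 ≤ m)
    have h1 := mul_mem_radPow hγ hc0
    have h2 := mul_mem_radPow hc0 hγ
    rw [add_zero] at h1
    rw [zero_add] at h2
    exact sub_mem h1 h2
  have e : γ * z - z * γ = (t : F) • (y - hτ.conj y + w) := by
    simp only [hz, hy, hw, map_sub, hτ.conj_mul, mul_smul_comm, smul_mul_assoc, ← smul_sub]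
    congr 1
    noncomm_ring
  by_contra hodd
  have hev := Int.not_odd_iff_even.1 hodd
  apply hzk
  rw [e]
  refine htm (add_mem ?_ hwm)
  have := neg_mem (hτ.conj_sub_mem hΛ hxk)
  rw [Int.negOnePow_even _ hev, Units.val_one, one_smul, neg_sub] at this
  exact this

end IsParityInvolution

end Parity

end SkewStrata

namespace SkewStrata

/-! ### The valuation on an abstract field `E` permuting the chain, and lifting an involution of `E`
to `V`. -/

section ScalarField

variable {F V E : Type*} [Field F] [ValuativeRel F] [AddCommGroup V] [Module F V]
  [Field E] [Module E V]

/-- Multiplication by `x` shifts the lattices of `Λ` by `k`. -/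
def IsShift (Λ : ℤ → Submodule 𝒪[F] V) (x : E) (k : ℤ) : Prop :=
  ∀ i v, x • v ∈ Λ (i + k) ↔ v ∈ Λ i

namespace IsShift

variable {Λ : ℤ → Submodule 𝒪[F] V} {x y : E} {k l : ℤ}

lemma one : IsShift Λ (1 : E) 0 := fun i v => by rw [one_smul, add_zero]

lemma mul (hx : IsShift Λ x k) (hy : IsShift Λ y l) : IsShift Λ (x * y) (k + l) := fun i v => by
  rw [mul_smul, ← hy i v, ← hx (i + l), add_assoc, add_comm l]

lemma inv (hx : IsShift Λ x k) (h0 : x ≠ 0) : IsShift Λ x⁻¹ (-k) := fun i v => by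
  rw [← hx, smul_inv_smul₀ h0, neg_add_cancel_right]

lemma pow (hx : IsShift Λ x k) (n : ℕ) : IsShift Λ (x ^ n) (n * k) := by
  induction n with
  | zero => simpa using one
  | succ n ih =>
    rw [pow_succ]
    convert ih.mul hx using 1
    push_cast; ring

lemma zpow (hx : IsShift Λ x k) (h0 : x ≠ 0) (n : ℤ) : IsShift Λ (x ^ n) (n * k) := by
  obtain ⟨n, rfl | rfl⟩ := n.eq_nat_or_neg
  · rw [zpow_natCast]; exact hx.pow n
  · rw [zpow_neg, zpow_natCast]
    convert (hx.pow n).inv (pow_ne_zero n h0) using 1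
    ring

variable [Algebra F E] [IsScalarTower F E V]

/-- The shift is the exact valuation: strictness of the chain rules out a deeper level. -/
lemma mem_radPow_iff (hx : IsShift Λ x k) (hΛ : StrictAnti Λ) {m : ℤ} :
    Algebra.lsmul F F V x ∈ radPow Λ m ↔ m ≤ k := by
  constructor
  · intro h
    by_contra hk
    obtain ⟨v, hv, hv'⟩ := SetLike.exists_of_lt (hΛ (by lia : (0 : ℤ) < 1))
    have h1 := hΛ.antitone (by lia : 1 + k ≤ 0 + m) (h 0 v hv)
    exact hv' ((hx 1 v).1 h1)
  · exact fun h i v hv => hΛ.antitone (by lia) ((hx i v).2 hv)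

lemma unique (hx : IsShift Λ x k) (hx' : IsShift Λ x l) (hΛ : StrictAnti Λ) : k = l :=
  le_antisymm ((hx'.mem_radPow_iff hΛ).1 ((hx.mem_radPow_iff hΛ).2 le_rfl))
    ((hx.mem_radPow_iff hΛ).1 ((hx'.mem_radPow_iff hΛ).2 le_rfl))

lemma ne_zero (hx : IsShift Λ x k) (hΛ : StrictAnti Λ) : x ≠ 0 := by
  rintro rfl
  have h : Algebra.lsmul F F V (0 : E) ∈ radPow Λ (k + 1) := by rw [map_zero]; exact zero_mem _
  have := (hx.mem_radPow_iff hΛ).1 h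
  lia

end IsShift

variable [Algebra F E] [IsScalarTower F E V] {Λ : ℤ → Submodule 𝒪[F] V}

/-- The valuation ring of the field `E`, whose nonzero elements permute the lattices of `Λ`. -/
def shiftRing (hΛ : StrictAnti Λ) (hN : ∀ x : E, x ≠ 0 → ∃ k, IsShift Λ x k) :
    ValuationSubring E where
  carrier := {x | Algebra.lsmul F F V x ∈ radPow Λ 0}
  mul_mem' {x y} hx hy := by
    have := mul_mem_radPow hx hy
    rwa [add_zero, ← map_mul] at this
  one_mem' := (IsShift.one.mem_radPow_iff hΛ).2 le_rfl
  add_mem' {x y} hx hy := by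
    have := add_mem (show _ ∈ radPow Λ 0 from hx) (show _ ∈ radPow Λ 0 from hy)
    rwa [← map_add] at this
  zero_mem' := by
    have := zero_mem (radPow Λ 0)
    rwa [← map_zero (Algebra.lsmul F F V : E →ₐ[F] _)] at this
  neg_mem' {x} hx := by
    have := neg_mem (show _ ∈ radPow Λ 0 from hx)
    rwa [← map_neg] at this
  mem_or_inv_mem' x := by
    by_cases h0 : x = 0
    · left
      have := zero_mem (radPow Λ 0)
      rw [← map_zero (Algebra.lsmul F F V : E →ₐ[F] _)] at this
      rwa [h0]
    · obtain ⟨k, hk⟩ := hN x h0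
      obtain h | h := le_total 0 k
      · exact Or.inl ((hk.mem_radPow_iff hΛ).2 h)
      · exact Or.inr (((hk.inv h0).mem_radPow_iff hΛ).2 (by lia))

lemma algebraMap_mem_shiftRing {hΛ : StrictAnti Λ} {hN : ∀ x : E, x ≠ 0 → ∃ k, IsShift Λ x k}
    (a : 𝒪[F]) : algebraMap F E a ∈ shiftRing hΛ hN := fun i v hv => by
  rw [Algebra.lsmul_apply, algebraMap_smul, add_zero]
  exact (Λ i).smul_mem a hv

lemma isUnit_shiftRing {hΛ : StrictAnti Λ} {hN : ∀ x : E, x ≠ 0 → ∃ k, IsShift Λ x k}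
    {x : shiftRing hΛ hN} (hx : IsShift Λ (x : E) 0) : IsUnit x := by
  have h0 := hx.ne_zero hΛ
  refine IsUnit.of_mul_eq_one ⟨(x : E)⁻¹, ?_⟩ (Subtype.ext (mul_inv_cancel₀ h0))
  exact ((hx.inv h0).mem_radPow_iff hΛ).2 (by simp)

lemma isDiscreteValuationRing_shiftRing {hΛ : StrictAnti Λ}
    {hN : ∀ x : E, x ≠ 0 → ∃ k, IsShift Λ x k} {ϖ : E} (hϖ : IsShift Λ ϖ 1) :
    IsDiscreteValuationRing (shiftRing hΛ hN) := by
  have hϖ0 := hϖ.ne_zero hΛ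
  have hmem : ϖ ∈ shiftRing hΛ hN := (hϖ.mem_radPow_iff hΛ).2 zero_le_one
  apply IsDiscreteValuationRing.ofHasUnitMulPowIrreducibleFactorization
  refine ⟨⟨ϖ, hmem⟩, ⟨?_, ?_⟩, ?_⟩
  · intro h
    obtain ⟨y, hy⟩ := h.exists_right_inv
    have hy' : ϖ * (y : E) = 1 := congrArg Subtype.val hy
    have := ((hϖ.inv hϖ0).mem_radPow_iff hΛ).1
      (eq_inv_of_mul_eq_one_right hy' ▸ y.2)
    lia
  · intro a b hab
    have hab' : ϖ = (a : E) * b := congrArg Subtype.val hab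
    obtain ⟨k, hk⟩ := hN a (by rintro h; simp [h, hϖ0] at hab')
    obtain ⟨l, hl⟩ := hN b (by rintro h; simp [h, hϖ0] at hab')
    have hk0 := (hk.mem_radPow_iff hΛ).1 a.2
    have hl0 := (hl.mem_radPow_iff hΛ).1 b.2
    have := (hab' ▸ hk.mul hl : IsShift Λ ϖ (k + l)).unique hϖ hΛ
    obtain rfl | rfl : k = 0 ∨ l = 0 := by lia
    · exact Or.inl (isUnit_shiftRing hk)
    · exact Or.inr (isUnit_shiftRing hl)
  · intro x hx
    obtain ⟨k, hk⟩ := hN x (by simpa using hx)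
    obtain ⟨n, rfl⟩ := Int.eq_ofNat_of_zero_le ((hk.mem_radPow_iff hΛ).1 x.2)
    have hu : IsShift Λ ((ϖ ^ n)⁻¹ * (x : E)) 0 := by
      convert ((hϖ.pow n).inv (pow_ne_zero n hϖ0)).mul hk using 1
      ring
    refine ⟨n, (isUnit_shiftRing (hΛ := hΛ) (hN := hN)
      (x := ⟨_, (hu.mem_radPow_iff hΛ).2 le_rfl⟩) hu).unit, Subtype.ext ?_⟩
    simp [mul_inv_cancel_left₀ (pow_ne_zero n hϖ0)]

/-- The elements of `E` integral over `𝔬_F` are those that preserve the lattices of `Λ`. -/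
lemma isIntegral_iff [TopologicalSpace F] [IsNonarchimedeanLocalField F]
    (hΛ : IsLatticeChain Λ) (hN : ∀ x : E, x ≠ 0 → ∃ k, IsShift Λ x k)
    (x : E) : IsIntegral 𝒪[F] x ↔ Algebra.lsmul F F V x ∈ radPow Λ 0 := by
  constructor
  -- The shift ring contains `𝔬_F` and, being a valuation ring, is integrally closed. The converse
  -- is the determinant trick on the finitely generated module `Λ 0`.
  · rintro ⟨p, hp, hpx⟩
    set O := shiftRing hΛ.strictAnti hN
    let φ : 𝒪[F] →+* O := ((algebraMap F E).comp (𝒪[F]).subtype).codRestrict O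
      algebraMap_mem_shiftRing
    have hx : IsIntegral O x := by
      refine ⟨p.map φ, hp.map φ, ?_⟩
      rw [Polynomial.eval₂_map]
      exact hpx
    obtain ⟨y, hy⟩ := IsIntegrallyClosed.isIntegral_iff.1 hx
    rw [← hy]
    exact y.2
  · intro hx
    have hne : Λ 0 ≠ ⊥ := (hΛ.strictAnti zero_lt_one).ne_bot
    exact isIntegral_of_smul_mem_submodule (Λ 0) hne (hΛ.fg 0) x
      fun v hv => by simpa using hx 0 v hv

/-- Coordinatewise application of an involution of `E` that acts by signs on the graded ring gives
a similar involution of `V`. -/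
theorem exists_parity_involution [TopologicalSpace F] [IsNonarchimedeanLocalField F]
    (hΛ : IsLatticeChain Λ)
    (hN : ∀ x : E, x ≠ 0 → ∃ k, IsShift Λ x k) {ϖ : E} (hϖ : IsShift Λ ϖ 1) (bar : E →+* E)
    (hbar : ∀ x, bar (bar x) = x)
    (hpar : ∀ k x, Algebra.lsmul F F V x ∈ radPow Λ k →
      Algebra.lsmul F F V (bar x - (k.negOnePow : ℤ) • x) ∈ radPow Λ (k + 1)) :
    ∃ τ : V →+ V, (∀ (x : E) v, τ (x • v) = bar x • τ v) ∧ (∀ v, τ (τ v) = v) ∧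
      ∀ k, ∀ v ∈ Λ k, τ v - (k.negOnePow : ℤ) • v ∈ Λ (k + 1) := by
  classical
  have hϖ0 := hϖ.ne_zero hΛ.strictAnti
  set O := shiftRing hΛ.strictAnti hN with hO
  have : IsDiscreteValuationRing O := isDiscreteValuationRing_shiftRing hϖ
  -- `Λ 0` as a module over the valuation ring of `E`; a lattice over a discrete valuation ring is
  -- free, and its basis is an `E`-basis of `V`.
  let L : Submodule O V :=
    { carrier := Λ 0
      add_mem' := (Λ 0).add_mem
      zero_mem' := (Λ 0).zero_mem
      smul_mem' := fun a v hv => by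
        have := a.2 0 v hv
        rwa [add_zero] at this }
  have hsmul : ∀ (a : 𝒪[F]) (v : V),
      a • v = (⟨_, algebraMap_mem_shiftRing a⟩ : O) • v := fun a v =>
    (algebraMap_smul E (a : F) v).symm
  have : L.IsLattice E :=
    { fg := by
        obtain ⟨s, hs⟩ := hΛ.fg 0
        refine ⟨s, le_antisymm (Submodule.span_le.2 fun v hv => ?_) fun v hv => ?_⟩
        · exact (hs ▸ Submodule.subset_span hv : v ∈ Λ 0)
        · have hv' : v ∈ Submodule.span 𝒪[F] (s : Set V) := hs ▸ hv
          clear hv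
          induction hv' using Submodule.span_induction with
          | mem v hv => exact Submodule.subset_span hv
          | zero => exact zero_mem _
          | add v w _ _ hv hw => exact add_mem hv hw
          | smul a v _ hv => rw [hsmul]; exact Submodule.smul_mem _ _ hv
      span_eq_top := by
        refine eq_top_iff.2 fun v _ => ?_
        have hv : v ∈ Submodule.span F (Λ 0 : Set V) := hΛ.span_eq_top 0 ▸ trivial
        exact Submodule.span_le_restrictScalars F E (Λ 0 : Set V) hv }
  let b := (Module.Free.chooseBasis O L).extendOfIsLattice E
  have hb0 : ∀ i, b i ∈ Λ 0 := fun i => by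
    simp only [b, Module.Basis.extendOfIsLattice_apply]
    exact (Module.Free.chooseBasis O L i).2
  have hrepr0 : ∀ v ∈ Λ 0, ∀ i, b.repr v i ∈ O := fun v hv i => by
    have h1 : b.repr v = Finsupp.mapRange (algebraMap O E) (map_zero _)
        ((Module.Free.chooseBasis O L).repr ⟨v, hv⟩) := by
      apply b.repr.symm.injective
      rw [LinearEquiv.symm_apply_apply, Module.Basis.repr_symm_apply,
        Finsupp.linearCombination_apply, Finsupp.sum_mapRange_index (by simp)]
      have h2 := congrArg L.subtype
        ((Module.Free.chooseBasis O L).linearCombination_repr ⟨v, hv⟩)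
      rw [Finsupp.linearCombination_apply, map_finsuppSum] at h2
      simp only [map_smul, Submodule.subtype_apply] at h2
      simp only [b, Module.Basis.extendOfIsLattice_apply]
      exact h2.symm
    rw [h1]
    exact ((Module.Free.chooseBasis O L).repr ⟨v, hv⟩ i).2
  -- Scaling by `ϖ^(-k)` reduces to `Λ 0`; this is where a shift by exactly one is needed.
  have hrepr : ∀ k, ∀ v ∈ Λ k, ∀ i, Algebra.lsmul F F V (b.repr v i) ∈ radPow Λ k := by
    intro k v hv i
    have hs := hϖ.zpow hϖ0 k
    rw [mul_one] at hs
    have hv0 : (ϖ ^ k)⁻¹ • v ∈ Λ 0 := by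
      have := (hs.inv (zpow_ne_zero k hϖ0) k v).2 hv
      rwa [add_neg_cancel] at this
    have h1 := mul_mem_radPow ((hs.mem_radPow_iff hΛ.strictAnti).2 le_rfl) (hrepr0 _ hv0 i)
    rw [← map_mul, add_zero] at h1
    simpa [mul_inv_cancel_left₀ (zpow_ne_zero k hϖ0)] using h1
  let τ : V →+ V :=
    { toFun := fun v => ∑ i, bar (b.repr v i) • b i
      map_zero' := by simp
      map_add' := fun v w => by simp [add_smul, Finset.sum_add_distrib] }
  have hτ : ∀ v, τ v = ∑ i, bar (b.repr v i) • b i := fun v => rfl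
  have hsemi : ∀ (x : E) v, τ (x • v) = bar x • τ v := fun x v => by
    simp [hτ, Finset.smul_sum, mul_smul]
  refine ⟨τ, hsemi, fun v => ?_, fun k v hv => ?_⟩
  · have hbτ : ∀ i, τ (b i) = b i := fun i => by
      rw [hτ, Finset.sum_eq_single i] <;> simp +contextual [eq_comm]
    rw [hτ v, map_sum]
    simp only [hsemi, hbar, hbτ]
    exact b.sum_repr v
  · have h1 : τ v - (k.negOnePow : ℤ) • v =
        ∑ i, (bar (b.repr v i) - (k.negOnePow : ℤ) • b.repr v i) • b i := by
      nth_rewrite 2 [← b.sum_repr v]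
      rw [hτ, Finset.smul_sum, ← Finset.sum_sub_distrib]
      exact Finset.sum_congr rfl fun i _ => by rw [sub_smul, smul_assoc]
    rw [h1]
    refine sum_mem fun i _ => ?_
    have := hpar k _ (hrepr k v hv i) 0 _ (hb0 i)
    rwa [zero_add] at this

end ScalarField

end SkewStrata

namespace SkewStrata

/-! ### Ramified involutions act by signs on the graded ring of `E`. -/

section ScalarInvolution

variable {F V E : Type*} [Field F] [ValuativeRel F] [AddCommGroup V] [Module F V]
  [Field E] [Algebra F E] [Module E V] [IsScalarTower F E V] {Λ : ℤ → Submodule 𝒪[F] V}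

lemma isShift_of_mem_of_notMem (hΛ : StrictAnti Λ) (hN : ∀ x : E, x ≠ 0 → ∃ k, IsShift Λ x k)
    {x : E} {k : ℤ} (hx : Algebra.lsmul F F V x ∈ radPow Λ k)
    (hx' : Algebra.lsmul F F V x ∉ radPow Λ (k + 1)) : IsShift Λ x k := by
  obtain ⟨l, hl⟩ := hN x (by rintro rfl; exact hx' (by rw [map_zero]; exact zero_mem _))
  rw [hl.mem_radPow_iff hΛ] at hx hx'
  obtain rfl : l = k := by lia
  exact hl

/-- An involution of `E` whose fixed field contains a uniformizer of valuation two, and no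
element of valuation one, acts by signs on the graded ring. -/
theorem bar_sub_mem (hΛ : StrictAnti Λ) (hN : ∀ x : E, x ≠ 0 → ∃ k, IsShift Λ x k)
    {bar : E →+* E} (hbar : ∀ x, bar (bar x) = x)
    (hpres : ∀ k x, Algebra.lsmul F F V x ∈ radPow Λ k → Algebra.lsmul F F V (bar x) ∈ radPow Λ k)
    {t : 𝒪[F]} (ht : 2 * t = 1) {ϖ ϖ' : E} (hϖ : IsShift Λ ϖ 1) (hϖ' : IsShift Λ ϖ' 2)
    (hfix : bar ϖ' = ϖ') (hno : ∀ y : E, bar y = y → ¬ IsShift Λ y 1) (k : ℤ) (x : E)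
    (hx : Algebra.lsmul F F V x ∈ radPow Λ k) :
    Algebra.lsmul F F V (bar x - (k.negOnePow : ℤ) • x) ∈ radPow Λ (k + 1) := by
  -- A fixed element of odd valuation, times a power of `ϖ'`, would be a fixed element of valuation
  -- one.
  have heven : ∀ (y : E) (l : ℤ), bar y = y → IsShift Λ y l → Even l := by
    intro y l hy hl
    by_contra hodd
    obtain ⟨m, rfl⟩ := Int.not_even_iff_odd.1 hodd
    refine hno (ϖ' ^ (-m) * y) (by rw [map_mul, map_zpow₀, hfix, hy]) ?_
    convert (hϖ'.zpow (hϖ'.ne_zero hΛ) (-m)).mul hl using 1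
    ring
  -- `ϖ - bar ϖ` works: `ϖ + bar ϖ` is fixed, so not of valuation one; if both had valuation at
  -- least two, so would `2ϖ`.
  have hskew : ∃ p : E, bar p = -p ∧ IsShift Λ p 1 := by
    have hϖ1 := (hϖ.mem_radPow_iff hΛ).2 le_rfl
    have hp1 : Algebra.lsmul F F V (ϖ - bar ϖ) ∈ radPow Λ 1 := by
      rw [map_sub]; exact sub_mem hϖ1 (hpres _ _ hϖ1)
    have hq1 : Algebra.lsmul F F V (ϖ + bar ϖ) ∈ radPow Λ 1 := by
      rw [map_add]; exact add_mem hϖ1 (hpres _ _ hϖ1)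
    refine ⟨ϖ - bar ϖ, by rw [map_sub, hbar, neg_sub],
      isShift_of_mem_of_notMem hΛ hN hp1 fun hp2 => ?_⟩
    refine hno (ϖ + bar ϖ) (by rw [map_add, hbar, add_comm])
      (isShift_of_mem_of_notMem hΛ hN hq1 fun hq2 => ?_)
    have h2 : Algebra.lsmul F F V ϖ ∈ radPow Λ (1 + 1) := by
      intro i v hv
      have h3 := (Λ _).smul_mem t (add_mem hp2 hq2 i v hv)
      have e : t • (Algebra.lsmul F F V (ϖ - bar ϖ) + Algebra.lsmul F F V (ϖ + bar ϖ)) v =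
          Algebra.lsmul F F V ϖ v := by
        rw [← map_add, sub_add_add_cancel, map_add, LinearMap.add_apply, ← two_smul 𝒪[F],
          smul_smul, mul_comm, ht, one_smul]
      rwa [e] at h3
    have := (hϖ.mem_radPow_iff hΛ).1 h2
    lia
  obtain ⟨p, hp, hp1⟩ := hskew
  have hk : Algebra.lsmul F F V (bar x - (k.negOnePow : ℤ) • x) ∈ radPow Λ k := by
    rw [map_sub, map_zsmul]
    exact sub_mem (hpres _ _ hx) (zsmul_mem hx _)
  -- Otherwise the difference has valuation exactly `k`. For `k` odd it is fixed; for `k` even it is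
  -- skew, and its product with `p` is fixed of odd valuation `k + 1`. Both contradict `heven`.
  by_contra hk'
  have hs := isShift_of_mem_of_notMem hΛ hN hk hk'
  rcases k.even_or_odd with he | ho
  · rw [Int.negOnePow_even _ he, Units.val_one, one_smul] at hs
    have := heven _ _ (by rw [map_mul, map_sub, hbar, hp]; ring) (hs.mul hp1)
    exact Int.not_even_iff_odd.2 he.add_one this
  · rw [Int.negOnePow_odd _ ho, Units.val_neg, Units.val_one, neg_smul, one_smul,
      sub_neg_eq_add] at hs
    exact Int.not_even_iff_odd.2 ho (heven _ _ (by rw [map_add, hbar, add_comm]) hs)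

lemma exists_isShift_of_normalizes [Nontrivial V] {L : Subalgebra F (Module.End F V)}
    (hL : Normalizes L Λ) (hE : Set.range (Algebra.lsmul F F V : E →ₐ[F] _) = (L : Set _)) (x : E)
    (hx : x ≠ 0) : ∃ k, IsShift Λ x k := by
  obtain ⟨k, hk⟩ := hL (Algebra.lsmul F F V x) (by rw [← SetLike.mem_coe, ← hE]; exact ⟨x, rfl⟩)
    (by
      intro h0
      obtain ⟨v, hv⟩ := exists_ne (0 : V)
      exact (smul_ne_zero hx hv) (LinearMap.congr_fun h0 v))
  refine ⟨k, fun i v => ?_⟩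
  rw [← SetLike.mem_coe, ← hk]
  exact ⟨fun ⟨w, hw, hwv⟩ => smul_right_injective V hx hwv ▸ hw, fun hv => ⟨v, hv, rfl⟩⟩

end ScalarInvolution

/-! ### The adjoint involution on `F[β]` and on the filtration. -/

section Adjoint

variable {F V E : Type*} [Field F] [AddCommGroup V] [Module F V]
  [Field E] [Algebra F E] [Module E V] [IsScalarTower F E V] {c : F →+* F}
  {h : V →ₗ[F] V →ₛₗ[c] F} {ε : F}

lemma IsHermitianForm.adjoint_symm (hh : IsHermitianForm h ε) {x y : Module.End F V}
    (hxy : ∀ v w, h (x v) w = h v (y w)) (v w : V) : h (y v) w = h v (x w) := by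
  rw [hh.symm, ← hxy, hh.symm v]

/-- Using Hermitian symmetry twice shows that `c ∘ c` fixes every value of `h`, and these values
fill `F`. -/
lemma IsHermitianForm.involutive [Nontrivial V] (hh : IsHermitianForm h ε) (a : F) :
    c (c a) = a := by
  obtain ⟨v, hv⟩ := exists_ne (0 : V)
  obtain ⟨w, hw⟩ : ∃ w, h v w ≠ 0 := by
    by_contra! H
    exact hv (hh.nondegenerate v H)
  have key : ∀ u, c (c (h u w)) = h u w := fun u => by
    have hε : ε * c ε = 1 := by rcases hh.sign with rfl | rfl <;> simp
    have h1 := hh.symm u w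
    rw [hh.symm w u, map_mul, ← mul_assoc, hε, one_mul] at h1
    exact h1.symm
  have h1 := key (a • v)
  rw [map_smul, LinearMap.smul_apply, smul_eq_mul, map_mul, map_mul, key] at h1
  exact mul_right_cancel₀ hw h1

/-- The adjoint involution restricts to the field `F[β]` for `β` skew. -/
theorem exists_adjoint [Nontrivial V] (hh : IsHermitianForm h ε) {β : Module.End F V}
    (hβ : IsSkew h β)
    (hE : Set.range (Algebra.lsmul F F V : E →ₐ[F] _) = (fieldOf β : Set (Module.End F V))) :
    ∃ bar : E →+* E, ∀ (x : E) v w, h (x • v) w = h v (bar x • w) := by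
  have huniq : ∀ y z : E, (∀ v w, h v (y • w) = h v (z • w)) → y = z := by
    intro y z H
    obtain ⟨w, hw⟩ := exists_ne (0 : V)
    have h0 : (y - z) • w = 0 := hh.nondegenerate _ fun v => by
      rw [hh.symm, sub_smul, map_sub, H, sub_self, map_zero, mul_zero]
    exact sub_eq_zero.1 ((smul_eq_zero.1 h0).resolve_right hw)
  have hmem : ∀ x : E, Algebra.lsmul F F V x ∈ fieldOf β := fun x => by
    rw [← SetLike.mem_coe, ← hE]; exact ⟨x, rfl⟩
  have hex' : ∀ x ∈ fieldOf β, ∃ y : E, ∀ v w, h (x v) w = h v (y • w) := by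
    intro x hx
    induction hx using Algebra.adjoin_induction with
    | mem x hx =>
      obtain rfl : x = β := hx
      obtain ⟨b, hb⟩ : x ∈ Set.range (Algebra.lsmul F F V : E →ₐ[F] _) := by
        rw [hE]; exact Algebra.subset_adjoin rfl
      refine ⟨-b, fun v w => ?_⟩
      rw [hβ, ← hb, neg_smul, Algebra.lsmul_apply]
    | algebraMap a =>
      refine ⟨algebraMap F E (c a), fun v w => ?_⟩
      rw [algebraMap_smul, map_smulₛₗ, hh.involutive, Module.algebraMap_end_apply, map_smul,
        LinearMap.smul_apply]
    | add x y _ _ hx hy =>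
      obtain ⟨x', hx⟩ := hx
      obtain ⟨y', hy⟩ := hy
      exact ⟨x' + y', fun v w => by simp [hx, hy, add_smul]⟩
    -- Adjoints reverse products, which is harmless as `E` is commutative.
    | mul x y _ _ hx hy =>
      obtain ⟨x', hx⟩ := hx
      obtain ⟨y', hy⟩ := hy
      refine ⟨y' * x', fun v w => ?_⟩
      rw [Module.End.mul_apply, hx, hy, mul_smul]
  choose bar hbar using fun x : E => hex' _ (hmem x)
  simp only [Algebra.lsmul_apply] at hbar
  refine ⟨{ toFun := bar, map_one' := ?_, map_mul' := ?_, map_zero' := ?_, map_add' := ?_ }, hbar⟩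
  · exact huniq _ _ fun v w => by rw [← hbar, one_smul, one_smul]
  · exact fun x y => huniq _ _ fun v w => by
      rw [← hbar, mul_comm x y, mul_smul, hbar, hbar, mul_smul]
  · exact huniq _ _ fun v w => by rw [← hbar, zero_smul, zero_smul, map_zero, map_zero,
      LinearMap.zero_apply]
  · exact fun x y => huniq _ _ fun v w => by
      rw [← hbar, add_smul, add_smul, map_add, map_add, LinearMap.add_apply, hbar, hbar]

/-- Duality turns the inclusion of `x Λ(a-i-k)` in `Λ(a-i)` into that of `y Λ(i)` in `Λ(i+k)`. -/
lemma adjoint_mem_radPow [ValuativeRel F] [TopologicalSpace F] [IsNonarchimedeanLocalField F]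
    {Λ : ℤ → Submodule 𝒪[F] V} (hΛ : IsSelfDual h Λ) {x y : Module.End F V}
    (hxy : ∀ v w, h (y v) w = h v (x w)) {k : ℤ} (hx : x ∈ radPow Λ k) : y ∈ radPow Λ k := by
  obtain ⟨a, ha⟩ := hΛ
  intro i v hv
  have := (ha (a - i - k) (y v)).2 fun w hw => by
    rw [hxy]
    refine (ha (a - i) v).1 (by rwa [sub_sub_cancel]) _ ?_
    have := hx _ w hw
    rwa [sub_add_cancel] at this
  rwa [show a - (a - i - k) = i + k by ring] at this

end Adjoint

/-! ### Integral units and uniformizers in terms of shifts; the parity involution attached to `β`.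
-/

section Ramified

variable {F V E : Type*} [Field F] [ValuativeRel F] [TopologicalSpace F]
  [IsNonarchimedeanLocalField F] [AddCommGroup V] [Module F V]
  [Field E] [Algebra F E] [Module E V] [IsScalarTower F E V] {c : F →+* F}
  {h : V →ₗ[F] V →ₛₗ[c] F} {ε : F} {Λ : ℤ → Submodule 𝒪[F] V}

lemma IsLatticeChain.nontrivial (hΛ : IsLatticeChain Λ) : Nontrivial V := by
  obtain ⟨v, -, hv⟩ := SetLike.exists_of_lt (hΛ.strictAnti (zero_lt_one : (0 : ℤ) < 1))
  exact ⟨v, 0, fun h0 => hv (h0 ▸ zero_mem _)⟩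

lemma isIntegral_lsmul_iff (hΛ : IsLatticeChain Λ) (hN : ∀ x : E, x ≠ 0 → ∃ k, IsShift Λ x k)
    (x : E) : IsIntegral 𝒪[F] (Algebra.lsmul F F V x) ↔ Algebra.lsmul F F V x ∈ radPow Λ 0 := by
  have := hΛ.nontrivial
  rw [← isIntegral_iff hΛ hN]
  exact isIntegral_algHom_iff ((Algebra.lsmul F F V : E →ₐ[F] _).restrictScalars 𝒪[F])
    (Algebra.lsmul F F V : E →ₐ[F] _).toRingHom.injective

lemma isIntegerUnit_iff (hΛ : IsLatticeChain Λ) (hN : ∀ x : E, x ≠ 0 → ∃ k, IsShift Λ x k)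
    {S : Set (Module.End F V)} (hS : Set.range (Algebra.lsmul F F V : E →ₐ[F] _) = S) (x : E) :
    IsIntegerUnit S (Algebra.lsmul F F V x) ↔ IsShift Λ x 0 := by
  have := hΛ.nontrivial
  subst hS
  constructor
  · rintro ⟨-, hx, _, ⟨w, rfl⟩, hw, h1⟩
    rw [isIntegral_lsmul_iff hΛ hN] at hx hw
    rw [← map_mul, ← map_one (Algebra.lsmul F F V : E →ₐ[F] _)] at h1
    have h1 := (Algebra.lsmul F F V : E →ₐ[F] _).toRingHom.injective h1
    obtain ⟨k, hk⟩ := hN x (left_ne_zero_of_mul_eq_one h1)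
    obtain ⟨l, hl⟩ := hN w (right_ne_zero_of_mul_eq_one h1)
    have h2 := (h1 ▸ hk.mul hl : IsShift Λ (1 : E) (k + l)).unique IsShift.one hΛ.strictAnti
    rw [hk.mem_radPow_iff hΛ.strictAnti] at hx
    rw [hl.mem_radPow_iff hΛ.strictAnti] at hw
    obtain rfl : k = 0 := by lia
    exact hk
  · intro hx
    have h0 := hx.ne_zero hΛ.strictAnti
    refine ⟨⟨x, rfl⟩, ?_, _, ⟨x⁻¹, rfl⟩, ?_, ?_⟩
    · rw [isIntegral_lsmul_iff hΛ hN, hx.mem_radPow_iff hΛ.strictAnti]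
    · rw [isIntegral_lsmul_iff hΛ hN, (hx.inv h0).mem_radPow_iff hΛ.strictAnti, neg_zero]
    · rw [← map_mul, mul_inv_cancel₀ h0, map_one]

/-- A uniformizer is a non-unit dividing `ϖ₀`, so its valuation is positive and at most one. -/
lemma isShift_one_of_isUniformizer (hΛ : IsLatticeChain Λ)
    (hN : ∀ x : E, x ≠ 0 → ∃ k, IsShift Λ x k) {S : Set (Module.End F V)}
    (hS : Set.range (Algebra.lsmul F F V : E →ₐ[F] _) = S) {ϖ₀ ϖ : E} (hϖ₀ : IsShift Λ ϖ₀ 1)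
    (hϖ : IsUniformizer S (Algebra.lsmul F F V ϖ)) : IsShift Λ ϖ 1 := by
  have := hΛ.nontrivial
  have hnu : ¬ IsIntegerUnit S (Algebra.lsmul F F V ϖ₀) := by
    rw [isIntegerUnit_iff hΛ hN hS]
    exact fun h0 => by have := h0.unique hϖ₀ hΛ.strictAnti; lia
  obtain ⟨y, hy, hyi, hxy⟩ := hϖ.dvd (Algebra.lsmul F F V ϖ₀) (hS ▸ ⟨ϖ₀, rfl⟩)
    (by rw [isIntegral_lsmul_iff hΛ hN, hϖ₀.mem_radPow_iff hΛ.strictAnti]; lia) hnu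
  obtain ⟨y, rfl⟩ : y ∈ Set.range (Algebra.lsmul F F V : E →ₐ[F] _) := hS ▸ hy
  rw [← map_mul] at hxy
  have hxy := (Algebra.lsmul F F V : E →ₐ[F] _).toRingHom.injective hxy
  have h0 := hϖ₀.ne_zero hΛ.strictAnti
  rw [hxy] at h0
  obtain ⟨k, hk⟩ := hN ϖ (left_ne_zero_of_mul h0)
  obtain ⟨l, hl⟩ := hN y (right_ne_zero_of_mul h0)
  have h2 := (hxy ▸ hk.mul hl : IsShift Λ ϖ₀ (k + l)).unique hϖ₀ hΛ.strictAnti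
  have hϖi := hϖ.isIntegral
  rw [isIntegral_lsmul_iff hΛ hN, hk.mem_radPow_iff hΛ.strictAnti] at hϖi
  rw [isIntegral_lsmul_iff hΛ hN, hl.mem_radPow_iff hΛ.strictAnti] at hyi
  have hk0 : k ≠ 0 := by
    rintro rfl
    exact hϖ.not_unit ((isIntegerUnit_iff hΛ hN hS ϖ).2 hk)
  obtain rfl : k = 1 := by lia
  exact hk

/-- For `β` skew with `E = F[β]` ramified over `E_•` and `Λ` of period one over `E`, there is a
parity involution of `V` that anti-commutes with `β`. -/
theorem exists_isParityInvolution (hh : IsHermitianForm h ε) {β : Module.End F V}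
    (hΛ : IsLatticeChain Λ) (hdual : IsSelfDual h Λ) (hβ : IsSkew h β)
    (hL : Normalizes (fieldOf β) Λ)
    (hmax : HasPeriodOne Λ (fieldOf β)) (hram : IsRamifiedOverFixed h (fieldOf β))
    {t : 𝒪[F]} (ht : 2 * t = 1)
    (hE : Set.range (Algebra.lsmul F F V : E →ₐ[F] _) = (fieldOf β : Set (Module.End F V))) :
    ∃ (τ : V →+ V) (hτ : IsParityInvolution Λ c τ), hτ.conj β = -β := by
  have := hΛ.nontrivial
  have hinj : Function.Injective (Algebra.lsmul F F V : E →ₐ[F] Module.End F V) :=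
    (Algebra.lsmul F F V : E →ₐ[F] _).toRingHom.injective
  have hsa := hΛ.strictAnti
  have hN := exists_isShift_of_normalizes hL hE
  obtain ⟨bar, hadj⟩ := exists_adjoint hh hβ hE
  have hadj' : ∀ (x : E) v w, h (bar x • v) w = h v (x • w) := fun x =>
    hh.adjoint_symm (x := Algebra.lsmul F F V x) (y := Algebra.lsmul F F V (bar x)) (hadj x)
  have huniq : ∀ y z : E, (∀ v w, h (y • v) w = h (z • v) w) → y = z := by
    intro y z H
    obtain ⟨w, hw⟩ := exists_ne (0 : V)
    have h0 : (y - z) • w = 0 := hh.nondegenerate _ fun v => by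
      rw [sub_smul, map_sub, LinearMap.sub_apply, H, sub_self]
    exact sub_eq_zero.1 ((smul_eq_zero.1 h0).resolve_right hw)
  have hbar : ∀ x, bar (bar x) = x := fun x => huniq _ _ fun v w => by rw [hadj', ← hadj]
  have hpres : ∀ k x, Algebra.lsmul F F V x ∈ radPow Λ k →
      Algebra.lsmul F F V (bar x) ∈ radPow Λ k := fun k x hx =>
    adjoint_mem_radPow hdual (hadj' x) hx
  have hfixed : ∀ x : E, Algebra.lsmul F F V x ∈ fixedField h (fieldOf β) ↔ bar x = x := by
    intro x
    constructor
    · rintro ⟨-, hx⟩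
      exact huniq _ _ fun v w => by rw [hadj']; exact (hx v w).symm
    · intro hx
      refine ⟨by rw [← SetLike.mem_coe, ← hE]; exact ⟨x, rfl⟩, fun v w => ?_⟩
      have := hadj x v w
      rwa [hx] at this
  obtain ⟨ϖ₀, hϖ₀u, hϖ₀⟩ := hmax
  obtain ⟨ϖ₀, rfl⟩ : ϖ₀ ∈ Set.range (Algebra.lsmul F F V : E →ₐ[F] _) := hE ▸ hϖ₀u.mem
  have hϖ₀1 : IsShift Λ ϖ₀ 1 := by
    have h0 : ϖ₀ ≠ 0 := by
      rintro rfl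
      obtain ⟨v, hv, hv'⟩ := SetLike.exists_of_lt (hsa (by lia : (0 + 1 : ℤ) < 1 + 1))
      rw [← SetLike.mem_coe, ← hϖ₀] at hv
      obtain ⟨w, -, rfl⟩ := hv
      exact hv' (by simp)
    intro i v
    rw [← SetLike.mem_coe, ← hϖ₀]
    exact ⟨fun ⟨w, hw, hwv⟩ => smul_right_injective V h0 hwv ▸ hw, fun hv => ⟨v, hv, rfl⟩⟩
  obtain ⟨ϖ, ϖ', u, hϖ, hϖ', hu, huϖ⟩ := hram
  obtain ⟨ϖ, rfl⟩ : ϖ ∈ Set.range (Algebra.lsmul F F V : E →ₐ[F] _) := hE ▸ hϖ.mem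
  obtain ⟨u, rfl⟩ : u ∈ Set.range (Algebra.lsmul F F V : E →ₐ[F] _) := hE ▸ hu.1
  rw [← map_pow, ← map_mul] at huϖ
  subst huϖ
  have hϖ1 := isShift_one_of_isUniformizer hΛ hN hE hϖ₀1 hϖ
  have hu0 := (isIntegerUnit_iff hΛ hN hE u).1 hu
  have hϖ'2 : IsShift Λ (u * ϖ ^ 2) 2 := by
    simpa using hu0.mul (hϖ1.pow 2)
  -- A fixed element of valuation one would be a non-unit of `𝔬_{E_•}`, hence a multiple of `ϖ'`,
  -- whose valuation is two.
  have hno : ∀ y : E, bar y = y → ¬ IsShift Λ y 1 := by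
    intro y hy hy1
    have hnu : ¬ IsIntegerUnit (fixedField h (fieldOf β)) (Algebra.lsmul F F V y) := by
      rintro ⟨-, hyi, w, hw, hwi, h1⟩
      have hyu := (isIntegerUnit_iff hΛ hN hE y).1 ⟨hE ▸ ⟨y, rfl⟩, hyi, w, hw.1, hwi, h1⟩
      have := hyu.unique hy1 hsa
      lia
    obtain ⟨z, hz, hzi, hyz⟩ := hϖ'.dvd _ ((hfixed y).2 hy)
      (by rw [isIntegral_lsmul_iff hΛ hN, hy1.mem_radPow_iff hsa]; lia) hnu
    obtain ⟨z, rfl⟩ : z ∈ Set.range (Algebra.lsmul F F V : E →ₐ[F] _) := hE ▸ hz.1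
    rw [← map_mul] at hyz
    have hyz := hinj hyz
    rw [isIntegral_lsmul_iff hΛ hN] at hzi
    obtain ⟨l, hl⟩ := hN z (by rintro rfl; exact hy1.ne_zero hsa (by rw [hyz, mul_zero]))
    rw [hl.mem_radPow_iff hsa] at hzi
    have := (hyz ▸ hϖ'2.mul hl : IsShift Λ y (2 + l)).unique hy1 hsa
    lia
  obtain ⟨τ, hsemi, hinv, hpar⟩ := exists_parity_involution hΛ hN hϖ1 bar hbar
    (bar_sub_mem hsa hN hbar hpres ht hϖ1 hϖ'2 ((hfixed _).1 hϖ'.mem) hno)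
  have hc : ∀ a : F, bar (algebraMap F E a) = algebraMap F E (c a) := fun a =>
    huniq _ _ fun v w => by
      rw [hadj', algebraMap_smul, algebraMap_smul, map_smulₛₗ, map_smul, LinearMap.smul_apply]
  refine ⟨τ, ⟨fun a v => ?_, hh.involutive, hinv, hpar⟩, ?_⟩
  · rw [← algebraMap_smul E a v, hsemi, hc, algebraMap_smul]
  · obtain ⟨b, hb⟩ : β ∈ Set.range (Algebra.lsmul F F V : E →ₐ[F] _) := by
      rw [hE]; exact Algebra.subset_adjoin rfl
    have hbb : bar b = -b := huniq _ _ fun v w => by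
      rw [hadj', neg_smul]
      have := hβ v w
      rw [← hb, Algebra.lsmul_apply, Algebra.lsmul_apply] at this
      rw [map_neg, LinearMap.neg_apply, this, map_neg, neg_neg]
    ext v
    rw [IsParityInvolution.conj_apply, ← hb, Algebra.lsmul_apply, hsemi, hinv, hbb]
    simp

end Ramified

lemma adjoinElt_bot {F V : Type*} [Field F] [AddCommGroup V] [Module F V] (b : Module.End F V) :
    adjoinElt ⊥ b = fieldOf b := by
  rw [adjoinElt, Algebra.adjoin_union, Algebra.adjoin_eq, bot_sup_eq, fieldOf]

lemma exists_two_mul_eq_one {F₀ F : Type*} [Field F₀] [ValuativeRel F₀] [Field F] [ValuativeRel F]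
    [Algebra F₀ F] [ValuativeExtension F₀ F] (hp : ringChar 𝓀[F₀] ≠ 2) :
    ∃ t : 𝒪[F], 2 * t = 1 := by
  have h2 : (2 : 𝓀[F₀]) ≠ 0 := Ring.two_ne_zero hp
  have hu : IsUnit (2 : 𝒪[F₀]) := by
    rw [← IsLocalRing.residue_ne_zero_iff_isUnit, map_ofNat]
    exact h2
  obtain ⟨s, hs⟩ := hu.exists_right_inv
  have hs1 : (s : F₀) ≤ᵥ 1 := by
    rw [Valuation.Compatible.vle_iff_le (v := valuation F₀), map_one]; exact s.2
  have hs2 : algebraMap F₀ F s ≤ᵥ 1 := by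
    rw [← map_one (algebraMap F₀ F)]
    exact (ValuativeExtension.vle_iff_vle _ _).2 hs1
  refine ⟨⟨algebraMap F₀ F s, ?_⟩, Subtype.ext ?_⟩
  · rw [Valuation.Compatible.vle_iff_le (v := valuation F), map_one] at hs2
    exact hs2
  · have := congrArg (fun z : 𝒪[F₀] => algebraMap F₀ F z) hs
    have h3 : algebraMap F₀ F ((2 : F₀) * (s : F₀)) = algebraMap F₀ F 1 := this
    rw [map_mul, map_ofNat, map_one] at h3
    exact h3

/-- The errors telescope; since the `r j` increase, the latest one dominates. -/
theorem IsApproximatingSequence.sub_mem {F V : Type*} [Field F] [ValuativeRel F]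
    [TopologicalSpace F] [IsNonarchimedeanLocalField F] [AddCommGroup V] [Module F V]
    {Λ : ℤ → Submodule 𝒪[F] V} {n : ℤ} {β : Module.End F V} {d : ℕ} {γ : ℕ → Module.End F V}
    {r : ℕ → ℤ} (hseq : IsApproximatingSequence Λ n β d γ r) (hΛ : Antitone Λ) :
    ∀ j < d, β - γ (j + 1) ∈ radPow Λ (-r j) := by
  intro j hj
  induction j with
  | zero => rw [← hseq.init]; exact hseq.equivalent 0 hj
  | succ j ih =>
    have h1 := radPow_anti hΛ (by have := hseq.lt_succ j (by lia); lia : -r (j + 1) ≤ -r j)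
      (ih (by lia))
    simpa using add_mem h1 (hseq.equivalent (j + 1) hj)

end SkewStrata

theorem proposition3p1 {F₀ F V : Type*}
    [Field F₀] [ValuativeRel F₀] [TopologicalSpace F₀] [IsNonarchimedeanLocalField F₀]
    [Field F] [ValuativeRel F] [TopologicalSpace F] [IsNonarchimedeanLocalField F]
    [Algebra F₀ F] [ValuativeExtension F₀ F]
    (hp : ringChar 𝓀[F₀] ≠ 2) (hF : Module.finrank F₀ F = 2)
    (c : F ≃ₐ[F₀] F) (hc : c ≠ AlgEquiv.refl)
    [AddCommGroup V] [Module F V] [FiniteDimensional F V]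
    (h : V →ₗ[F] V →ₛₗ[(c : F →+* F)] F) (ε : F) (hh : SkewStrata.IsHermitianForm h ε)
    (Λ : ℤ → Submodule 𝒪[F] V) (n : ℤ) (β : Module.End F V)
    (hs : SkewStrata.IsSkewSimple h Λ n β)
    (hmax : SkewStrata.HasPeriodOne Λ (SkewStrata.fieldOf β))
    (hram : SkewStrata.IsRamifiedOverFixed h (SkewStrata.fieldOf β))
    (d : ℕ) (γ : ℕ → Module.End F V) (r : ℕ → ℤ)
    (hseq : SkewStrata.IsApproximatingSequence Λ n β d γ r) :
    ∀ j ≤ d, Odd (r j) := by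
  open SkewStrata in
  obtain ⟨t, ht⟩ := exists_two_mul_eq_one (F₀ := F₀) (F := F) hp
  have hanti := hs.chain.strictAnti.antitone
  have hfield : IsField (fieldOf β) := adjoinElt_bot β ▸ hs.simple.isField
  have hnorm : Normalizes (fieldOf β) Λ := adjoinElt_bot β ▸ hs.simple.normalizes
  obtain ⟨τ, hτ, hconj⟩ : ∃ (τ : V →+ V) (hτ : IsParityInvolution Λ (c : F →+* F) τ),
      hτ.conj β = -β := by
    let : Field (fieldOf β) := hfield.toField
    refine exists_isParityInvolution (E := fieldOf β) hh hs.chain hs.selfDual hs.skew hnorm hmax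
      hram ht ?_
    ext x
    exact ⟨fun ⟨y, hy⟩ => hy ▸ y.2, fun hx => ⟨⟨x, hx⟩, rfl⟩⟩
  intro j hj
  -- The exponent `r d = n` is treated through the valuation of `β`, because `k₀(γ d, 𝔄)` may be
  -- `-∞`.
  obtain hj | rfl := hj.lt_or_eq
  · rw [← odd_neg]
    obtain _ | j := j
    · refine hτ.odd_critical hanti ht (hseq.critical 0 hj) (lt_add_one _) ?_
      rw [hseq.init, hconj, add_neg_cancel]
      exact zero_mem _
    · refine hτ.odd_critical hanti ht (hseq.critical _ hj)
        (neg_lt_neg (hseq.lt_succ j (by lia))) ?_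
      -- `β` cancels in the sum of `γ (j + 1) - β` and its conjugate, leaving `γ (j + 1)` plus its
      -- conjugate in `𝔓^(-r j)`, with `-r j > -r (j + 1)`.
      have h1 := neg_mem (hseq.sub_mem hanti j (by lia))
      rw [neg_sub] at h1
      have h2 := add_mem (radPow_anti hanti (by lia) (hτ.conj_sub_mem hanti h1))
        (zsmul_mem h1 ((-r j).negOnePow : ℤ))
      rw [sub_add_cancel] at h2
      have h3 := add_mem h1 h2
      rw [map_sub, hconj] at h3
      convert h3 using 1
      abel
  · rw [hseq.last, ← odd_neg]
    refine hτ.odd_of_add_conj_mem hanti ht hs.simple.mem hs.simple.notMem ?_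
    rw [hconj, add_neg_cancel]
    exact zero_mem _
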